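/- Let $d\ge 2$. Let $A(d,1)$ be the space of lines in $\mathbb R^d$ with its usual topology, and let $\Theta$ be a locally finite Borel measure on $A(d,1)^2$ which is separately translation invariant, that is, $\Theta(\{(L_1+x_1,L_2+x_2):(L_1,L_2)\in B\})=\Theta(B)$ for every Borel set $B\subset A(d,1)^2$ and all $x_1,x_2\in\mathbb R^d$. For convex bodies (nonempty compact convex sets) $K_1,K_2\subset\mathbb R^d$ put $$J(K_1,K_2,\Theta):=\Theta(\{(G_1,G_2)\in A(d,1)^2: G_1\cap K_1\neq\emptyset,\ G_2\cap K_2\neq\emptyset\}),\qquad J(K,\Theta):=J(K,K,\Theta).$$ Let $B^d$ be the closed unit ball, and let $S(K)$ be the surface area of $K$, that is, the right derivative at $t=0$ of the volume of $K+tB^d$ (twice the intrinsic volume $V_{d-1}(K)$). A convex body has constant brightness if the $(d-1)$-dimensional volume of its orthogonal projection to $u^\perp$ is the same for all unit vectors $u$. If $K_1$ and $K_2$ are convex bodies of constant brightness, then $$J(K_1,K_2,\Theta)=\kappa[\Theta]\,S(K_1)\,S(K_2),\qquad\text{where }\kappa[\Theta]:=\frac{J(B^d,\Theta)}{S(B^d)^2}<\infty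 .$$ -/

import Mathlib

open MeasureTheory
open scoped ENNReal Pointwise

noncomputable section

namespace LinePairs

/-- The affine Grassmannian `A(d,1)` of lines (one-dimensional affine subspaces) of `ℝᵈ`. -/
@[ext] structure Line (d : ℕ) where
  /-- the underlying affine subspace -/
  carrier : AffineSubspace ℝ (EuclideanSpace ℝ (Fin d))
  nonempty : (carrier : Set (EuclideanSpace ℝ (Fin d))).Nonempty
  finrank_direction : Module.finrank ℝ carrier.direction = 1

variable {d : ℕ}

/-- The line `x + lin {u}` through the point `x` parallel to the unit vector `u`. -/
def Line.through (p : Metric.sphere (0 : EuclideanSpace ℝ (Fin d)) 1 ×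
    EuclideanSpace ℝ (Fin d)) : Line d where
  carrier := AffineSubspace.mk' p.2 (Submodule.span ℝ {(p.1 : EuclideanSpace ℝ (Fin d))})
  nonempty := AffineSubspace.mk'_nonempty _ _
  finrank_direction := by
    rw [AffineSubspace.direction_mk']
    exact finrank_span_singleton (Metric.ne_of_mem_sphere p.1.2 one_ne_zero)

/-- The usual topology of `A(d,1)`: the finest one for which the line `x + lin {u}` depends
continuously on the unit vector `u` and on the point `x`. -/
instance Line.instTopologicalSpace : TopologicalSpace (Line d) :=
  TopologicalSpace.coinduced Line.through inferInstance

/-- The Borel `σ`-algebra of `A(d,1)`. -/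
instance Line.instMeasurableSpace : MeasurableSpace (Line d) := borel (Line d)

instance Line.instBorelSpace : BorelSpace (Line d) := ⟨rfl⟩

theorem Line.through_eq_iff {p q : Metric.sphere (0 : EuclideanSpace ℝ (Fin d)) 1 ×
    EuclideanSpace ℝ (Fin d)} :
    Line.through p = Line.through q ↔
      (q.1 = p.1 ∨ q.1 = -p.1) ∧
        ∃ t : ℝ, q.2 = p.2 + t • (p.1 : EuclideanSpace ℝ (Fin d)) := by
  have hp : ‖(p.1 : EuclideanSpace ℝ (Fin d))‖ = 1 := by simp
  have hq : ‖(q.1 : EuclideanSpace ℝ (Fin d))‖ = 1 := by simp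
  constructor
  · intro h
    have h' : AffineSubspace.mk' p.2 (Submodule.span ℝ {(p.1 : EuclideanSpace ℝ (Fin d))}) =
        AffineSubspace.mk' q.2 (Submodule.span ℝ {(q.1 : EuclideanSpace ℝ (Fin d))}) :=
      congrArg Line.carrier h
    constructor
    · have hd := congrArg AffineSubspace.direction h'
      rw [AffineSubspace.direction_mk', AffineSubspace.direction_mk'] at hd
      have hm : (q.1 : EuclideanSpace ℝ (Fin d)) ∈
          Submodule.span ℝ {(p.1 : EuclideanSpace ℝ (Fin d))} := by
        rw [hd]; exact Submodule.mem_span_singleton_self _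
      obtain ⟨a, ha⟩ := Submodule.mem_span_singleton.1 hm
      have habs : |a| = 1 := by
        have h2 := congrArg norm ha
        rw [norm_smul, hp, hq] at h2
        simpa using h2
      rcases (abs_eq zero_le_one).1 habs with h1 | h1
      · left; apply Subtype.ext; rw [← ha, h1, one_smul]
      · right; apply Subtype.ext
        rw [← ha, h1]; simp
    · have hm : q.2 ∈ AffineSubspace.mk' p.2
          (Submodule.span ℝ {(p.1 : EuclideanSpace ℝ (Fin d))}) := by
        rw [h']; exact AffineSubspace.self_mem_mk' _ _
      rw [AffineSubspace.mem_mk'] at hm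
      obtain ⟨t, ht⟩ := Submodule.mem_span_singleton.1 hm
      exact ⟨t, by rw [ht]; simp⟩
  · rintro ⟨hu, t, ht⟩
    have hs : Submodule.span ℝ {(q.1 : EuclideanSpace ℝ (Fin d))} =
        Submodule.span ℝ {(p.1 : EuclideanSpace ℝ (Fin d))} := by
      rcases hu with hu | hu
      · rw [hu]
      · rw [hu, coe_neg_sphere, ← Set.neg_singleton, Submodule.span_neg]
    apply Line.ext
    change AffineSubspace.mk' p.2 _ = AffineSubspace.mk' q.2 _
    rw [hs]
    have hm : q.2 ∈ AffineSubspace.mk' p.2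
        (Submodule.span ℝ {(p.1 : EuclideanSpace ℝ (Fin d))}) := by
      rw [AffineSubspace.mem_mk', ht]
      exact Submodule.mem_span_singleton.2 ⟨t, by simp⟩
    have h := AffineSubspace.mk'_eq hm
    rw [AffineSubspace.direction_mk'] at h
    exact h.symm

theorem Line.isOpenQuotientMap_through : IsOpenQuotientMap (Line.through (d := d)) := by
  refine ⟨?_, continuous_coinduced_rng, ?_⟩
  · intro L
    obtain ⟨x, hx⟩ := L.nonempty
    obtain ⟨v, hv0, hv⟩ := finrank_eq_one_iff'.1 L.finrank_direction
    have hn : ‖(v : EuclideanSpace ℝ (Fin d))‖ ≠ 0 := by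
      simpa using hv0
    have hspan : L.carrier.direction =
        Submodule.span ℝ {‖(v : EuclideanSpace ℝ (Fin d))‖⁻¹ • (v : EuclideanSpace ℝ (Fin d))} := by
      rw [Submodule.span_singleton_smul_eq (IsUnit.mk0 _ (inv_ne_zero hn))]
      ext w
      rw [Submodule.mem_span_singleton]
      constructor
      · intro hw
        obtain ⟨c, hc⟩ := hv ⟨w, hw⟩
        exact ⟨c, by simpa using congrArg Subtype.val hc⟩
      · rintro ⟨c, rfl⟩
        exact Submodule.smul_mem _ c v.2
    refine ⟨(⟨‖(v : EuclideanSpace ℝ (Fin d))‖⁻¹ • (v : EuclideanSpace ℝ (Fin d)), ?_⟩, x), ?_⟩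
    · rw [mem_sphere_zero_iff_norm, norm_smul, norm_inv, norm_norm, inv_mul_cancel₀ hn]
    · apply Line.ext
      change AffineSubspace.mk' x (Submodule.span ℝ {_}) = L.carrier
      rw [← hspan]
      exact AffineSubspace.mk'_eq hx
  · intro U hU
    change IsOpen (Line.through ⁻¹' (Line.through '' U))
    have key : Line.through ⁻¹' (Line.through '' U) =
        ⋃ t : ℝ, ((fun p : Metric.sphere (0 : EuclideanSpace ℝ (Fin d)) 1 ×
            EuclideanSpace ℝ (Fin d) =>
              (p.1, p.2 + t • (p.1 : EuclideanSpace ℝ (Fin d)))) ⁻¹' U ∪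
          (fun p : Metric.sphere (0 : EuclideanSpace ℝ (Fin d)) 1 ×
            EuclideanSpace ℝ (Fin d) =>
              (-p.1, p.2 + t • (p.1 : EuclideanSpace ℝ (Fin d)))) ⁻¹' U) := by
      ext p
      simp only [Set.mem_preimage, Set.mem_image, Set.mem_iUnion, Set.mem_union]
      constructor
      · rintro ⟨⟨u, y⟩, hq, h⟩
        obtain ⟨hu, t, ht⟩ := Line.through_eq_iff.1 h.symm
        refine ⟨t, ?_⟩
        simp only at hu ht
        rcases hu with rfl | rfl
        · left; rw [← ht]; exact hq
        · right; rw [← ht]; exact hq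
      · rintro ⟨t, h | h⟩
        · exact ⟨_, h, Eq.symm (Line.through_eq_iff.2 ⟨Or.inl (by rfl), t, by rfl⟩)⟩
        · exact ⟨_, h, Eq.symm (Line.through_eq_iff.2 ⟨Or.inr (by rfl), t, by rfl⟩)⟩
    rw [key]
    refine isOpen_iUnion fun t => (hU.preimage ?_).union (hU.preimage ?_)
    · fun_prop
    · refine Continuous.prodMk ?_ (by fun_prop)
      exact continuous_neg.comp continuous_fst

instance Line.instSecondCountableTopology : SecondCountableTopology (Line d) :=
  Line.isOpenQuotientMap_through.isQuotientMap.secondCountableTopology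
    Line.isOpenQuotientMap_through.isOpenMap

/-- The `σ`-algebra carried by `A(d,1)²` is the Borel `σ`-algebra of the product topology. -/
theorem borelSpace_line_prod : BorelSpace (Line d × Line d) := inferInstance

/-- The translate `L + x` of a line. -/
def Line.translate (x : EuclideanSpace ℝ (Fin d)) (L : Line d) : Line d where
  carrier := x +ᵥ L.carrier
  nonempty := by
    rw [AffineSubspace.coe_pointwise_vadd]
    exact L.nonempty.vadd_set
  finrank_direction := by
    rw [AffineSubspace.pointwise_vadd_direction]
    exact L.finrank_direction

/-- A Borel measure `Θ` on `A(d,1)²` is separately translation invariant if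
`Θ {(L₁ + x₁, L₂ + x₂) : (L₁, L₂) ∈ B} = Θ B` for all Borel sets `B` and all `x₁, x₂ ∈ ℝᵈ`. -/
def SeparatelyTranslationInvariant (Θ : Measure (Line d × Line d)) : Prop :=
  ∀ B : Set (Line d × Line d), MeasurableSet B → ∀ x₁ x₂ : EuclideanSpace ℝ (Fin d),
    Θ ((fun L : Line d × Line d => (L.1.translate x₁, L.2.translate x₂)) '' B) = Θ B

/-- `J(K₁, K₂, Θ)`, the `Θ`-measure of the set of all pairs `(G₁, G₂)` of lines such that
`G₁` meets `K₁` and `G₂` meets `K₂`. -/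
def J (K₁ K₂ : ConvexBody (EuclideanSpace ℝ (Fin d))) (Θ : Measure (Line d × Line d)) : ℝ≥0∞ :=
  Θ {G | ((G.1.carrier : Set (EuclideanSpace ℝ (Fin d))) ∩ K₁).Nonempty ∧
         ((G.2.carrier : Set (EuclideanSpace ℝ (Fin d))) ∩ K₂).Nonempty}

/-- The closed unit ball `Bᵈ`. -/
def unitBall (d : ℕ) : ConvexBody (EuclideanSpace ℝ (Fin d)) where
  carrier := Metric.closedBall 0 1
  convex' := convex_closedBall 0 1
  isCompact' := isCompact_closedBall 0 1
  nonempty' := Metric.nonempty_closedBall.2 zero_le_one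

/-- The surface area `S(K)` of a convex body in Minkowski's form: the right derivative at
`t = 0` of the volume of the parallel body `K + t Bᵈ`. By the Steiner formula
`V_d(K + t Bᵈ) = ∑ₖ t^(d-k) κ_(d-k) V_k(K)`, in which `κ₁ = 2`, this is `2 V_(d-1)(K)`. -/
def surfaceArea (K : ConvexBody (EuclideanSpace ℝ (Fin d))) : ℝ :=
  derivWithin (fun t : ℝ => volume.real
    ((K : Set (EuclideanSpace ℝ (Fin d))) + t • (unitBall d : Set (EuclideanSpace ℝ (Fin d)))))
    (Set.Ici 0) 0

/-- The brightness function of `K`: for a unit vector `u`, the `(d-1)`-dimensional volume of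
the orthogonal projection of `K` to the hyperplane `u^⊥`. -/
def brightness (K : ConvexBody (EuclideanSpace ℝ (Fin d))) (u : EuclideanSpace ℝ (Fin d)) : ℝ :=
  (volume : Measure (Submodule.span ℝ {u})ᗮ).real
    ((Submodule.span ℝ {u})ᗮ.orthogonalProjectionOnto '' (K : Set (EuclideanSpace ℝ (Fin d))))

/-- `K` has constant brightness if its brightness function is constant on the unit sphere. -/
def HasConstantBrightness (K : ConvexBody (EuclideanSpace ℝ (Fin d))) : Prop :=
  ∃ b : ℝ, ∀ u : EuclideanSpace ℝ (Fin d), ‖u‖ = 1 → brightness K u = b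

/-- The constant `κ[Θ] = J(Bᵈ, Θ) / S(Bᵈ)²`, where `J(K, Θ) = J(K, K, Θ)`. -/
def kappa (Θ : Measure (Line d × Line d)) : ℝ≥0∞ :=
  J (unitBall d) (unitBall d) Θ / ENNReal.ofReal (surfaceArea (unitBall d)) ^ 2

end LinePairs

end

/-!
The proof reduces both sides to the brightnesses of the bodies, with the unit ball `B` as a
reference body. Write `b K` for the constant brightness of `K`.

The left side: `b B ^ 2 * J K₁ K₂ Θ = b K₁ * b K₂ * J B B Θ` (`brightness_mul_J`). By invariance it
suffices to compare two bodies `A` and `C` met by the first line while the second line is a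
spectator, and this needs no disintegration of `Θ`. The translations `x`, in the slab of width one
perpendicular to `L`, for which `L + x` meets `C` have volume `b C`, by Cavalieri. So the measure of
the triples `(L₁, L₂, x)` for which `L₁` meets `A`, `x` lies in the slab and `L₁ + x` meets `C` is
`b C` times the measure of the pairs whose first line meets `A`; after the substitution of `L₁ + x`
for `L₁` it is `b A` times the measure of the pairs whose first line meets `C`
(`brightness_mul_measure_hits`). Pairs of lines meeting given bodies form a compact set, whence
`J B B Θ < ⊤`.

The right side: the surface area exists as a derivative and equals `S B / b B * b K`
(`surfaceArea_eq_mul_brightness`), a case of Cauchy's surface area formula. Adding to a convex body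
a segment parallel to `u` increases the volume by the length of the segment times the brightness
in direction `u` (`volume_add_segment`). Hence, if `Z` is a zonotope with
`(1 - ε) B ⊆ Z ⊆ B` and `W` is the total length of its segments, the difference quotients of the
volume of `K + t B` lie between `W * b K` and, asymptotically, `W * b K / (1 - ε)`
(`volume_parallel_bounds`). Such zonotopes exist because the unit ball is a zonoid
(`exists_zonotope_approx`). The number `W` need not be computed: the same bounds for `K = B`, where
the volume is a polynomial in `t`, determine it as `ε` tends to zero.
-/

open Filter Topology

namespace LinePairs

/-! ### Volume and projection along a direction -/

section Cavalieri

variable {E : Type*} [NormedAddCommGroup E] [InnerProductSpace ℝ E]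

theorem projection_smul_add (u : E) (s : ℝ) (y : (Submodule.span ℝ {u})ᗮ) :
    (Submodule.span ℝ {u})ᗮ.orthogonalProjectionOnto (s • u + (y : E)) = y := by
  rw [map_add, map_smul, Submodule.orthogonalProjectionOnto_mem_subspace_eq_self,
    Submodule.orthogonalProjectionOnto_orthogonal_apply_eq_zero
      (Submodule.mem_span_singleton_self u), smul_zero, zero_add]

theorem exists_eq_smul_add (u x : E) :
    ∃ s : ℝ, x = s • u + ((Submodule.span ℝ {u})ᗮ.orthogonalProjectionOnto x : E) := by
  obtain ⟨s, hs⟩ := Submodule.mem_span_singleton.1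
    ((Submodule.span ℝ {u}).orthogonalProjectionOnto x).2
  refine ⟨s, ?_⟩
  rw [hs]
  simp

theorem mem_projection_image_iff {u : E} {A : Set E} {y : (Submodule.span ℝ {u})ᗮ} :
    y ∈ (Submodule.span ℝ {u})ᗮ.orthogonalProjectionOnto '' A ↔ ∃ s : ℝ, s • u + (y : E) ∈ A := by
  constructor
  · rintro ⟨x, hx, rfl⟩
    obtain ⟨s, hs⟩ := exists_eq_smul_add u x
    exact ⟨s, hs ▸ hx⟩
  · rintro ⟨s, hs⟩
    exact ⟨_, hs, projection_smul_add u s y⟩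

theorem isCompact_projection_image {u : E} {A : Set E} (hA : IsCompact A) :
    IsCompact ((Submodule.span ℝ {u})ᗮ.orthogonalProjectionOnto '' A) :=
  hA.image (Submodule.span ℝ {u})ᗮ.orthogonalProjectionOnto.continuous

variable [FiniteDimensional ℝ E] [MeasurableSpace E] [BorelSpace E]

theorem measurePreserving_smul_add {u : E} (hu : ‖u‖ = 1) :
    MeasurePreserving (fun p : ℝ × (Submodule.span ℝ {u})ᗮ => p.1 • u + (p.2 : E)) := by
  have h1 : MeasurePreserving (Prod.map (LinearIsometryEquiv.toSpanUnitSingleton u hu)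
      (id : (Submodule.span ℝ {u})ᗮ → (Submodule.span ℝ {u})ᗮ)) volume volume :=
    (LinearIsometryEquiv.measurePreserving _).prod (MeasurePreserving.id _)
  have h2 := (Submodule.orthogonalDecomposition
    (Submodule.span ℝ {u})).symm.measurePreserving.comp
      ((WithLp.volume_preserving_toLp (U := Submodule.span ℝ {u})
        (V := (Submodule.span ℝ {u})ᗮ)).comp h1)
  have h3 : (fun p : ℝ × (Submodule.span ℝ {u})ᗮ => p.1 • u + (p.2 : E)) =
      (Submodule.orthogonalDecomposition (Submodule.span ℝ {u})).symm ∘ WithLp.toLp 2 ∘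
        Prod.map (LinearIsometryEquiv.toSpanUnitSingleton u hu) id := by
    funext p
    simp [Submodule.orthogonalDecomposition_symm_apply]
  rw [h3]
  exact h2

/-- Cavalieri's principle for the lines parallel to the unit vector `u`. -/
theorem volume_eq_lintegral_fiber {u : E} (hu : ‖u‖ = 1) {A : Set E} (hA : MeasurableSet A) :
    volume A = ∫⁻ y : (Submodule.span ℝ {u})ᗮ, volume {s : ℝ | s • u + (y : E) ∈ A} := by
  have h := measurePreserving_smul_add hu
  rw [← h.measure_preimage hA.nullMeasurableSet, Measure.volume_eq_prod,
    Measure.prod_apply_symm (h.measurable hA)]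
  rfl

/-- The part of a cylinder over `P` lying in a slab of width one has the volume of the base. -/
theorem volume_slab_inter_cylinder {u : E} (hu : ‖u‖ = 1) {P : Set (Submodule.span ℝ {u})ᗮ}
    (hP : MeasurableSet P) :
    volume {x : E | |inner ℝ u x| ≤ 1 / 2 ∧
      (Submodule.span ℝ {u})ᗮ.orthogonalProjectionOnto x ∈ P} = volume P := by
  have hm : MeasurableSet {x : E | |inner ℝ u x| ≤ 1 / 2 ∧
      (Submodule.span ℝ {u})ᗮ.orthogonalProjectionOnto x ∈ P} := by
    refine MeasurableSet.inter ?_ ?_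
    · exact (isClosed_le
      ((continuous_const.inner continuous_id).abs : Continuous fun x : E => |inner ℝ u x|)
      continuous_const).measurableSet
    · exact (Submodule.span ℝ {u})ᗮ.orthogonalProjectionOnto.continuous.measurable hP
  rw [volume_eq_lintegral_fiber hu hm, ← lintegral_indicator_one hP]
  congr 1
  ext y
  have hy : inner ℝ u (y : E) = 0 :=
    Submodule.mem_orthogonal_singleton_iff_inner_right.1 y.2
  by_cases h : y ∈ P
  · have : {s : ℝ | |s| ≤ 1 / 2} = Set.Icc (-(1 / 2)) (1 / 2) := by
      ext s; simp [abs_le]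
    simp only [Set.mem_ofPred_eq, projection_smul_add, h, and_true, inner_add_right,
      inner_smul_right, real_inner_self_eq_norm_sq, hu, hy, Set.indicator_of_mem, Pi.one_apply]
    norm_num
    norm_num at this
    rw [this]
    norm_num
  · simp [projection_smul_add, h]

/-- Adding a segment parallel to `u` to a convex body enlarges its volume by the length of the
segment times the volume of the projection along `u`: every fibre, being an interval, grows by the
length of the segment. -/
theorem volume_add_segment {u : E} (hu : ‖u‖ = 1) {A : Set E} (hA : IsCompact A)
    (hconv : Convex ℝ A) {a b : ℝ} (hab : a ≤ b) :
    volume (A + (fun s : ℝ => s • u) '' Set.Icc a b) = volume A + ENNReal.ofReal (b - a) *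
      volume ((Submodule.span ℝ {u})ᗮ.orthogonalProjectionOnto '' A) := by
  have hseg : IsCompact ((fun s : ℝ => s • u) '' Set.Icc a b) :=
    isCompact_Icc.image (by fun_prop)
  have hP := (isCompact_projection_image (u := u) hA).measurableSet
  rw [volume_eq_lintegral_fiber hu (hA.add hseg).measurableSet,
    volume_eq_lintegral_fiber hu hA.measurableSet, ← lintegral_indicator_const hP,
    ← lintegral_add_right _ (measurable_const.indicator hP)]
  congr 1
  ext y
  set F : Set ℝ := {s : ℝ | s • u + (y : E) ∈ A}
  have hF : {s : ℝ | s • u + (y : E) ∈ A + (fun s : ℝ => s • u) '' Set.Icc a b} =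
      F + Set.Icc a b := by
    ext s
    simp only [Set.mem_ofPred_eq, Set.mem_add, Set.mem_image]
    constructor
    · rintro ⟨x, hx, _, ⟨t, ht, rfl⟩, h⟩
      refine ⟨s - t, ?_, t, ht, by ring⟩
      change (s - t) • u + (y : E) ∈ A
      rw [show (s - t) • u + (y : E) = x by rw [sub_smul, eq_sub_of_add_eq h]; abel]
      exact hx
    · rintro ⟨r, hr, t, ht, rfl⟩
      exact ⟨r • u + (y : E), hr, _, ⟨t, ht, rfl⟩, by module⟩
  rw [hF]
  by_cases hy : y ∈ (Submodule.span ℝ {u})ᗮ.orthogonalProjectionOnto '' A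
  · obtain ⟨s₀, hs₀⟩ := mem_projection_image_iff.1 hy
    have hFc : IsCompact F := by
      have hcl : Topology.IsClosedEmbedding (fun s : ℝ => s • u + (y : E)) := by
        refine Isometry.isClosedEmbedding (Isometry.of_dist_eq fun s t => ?_)
        rw [dist_add_right, dist_eq_norm, ← sub_smul, norm_smul, hu, mul_one, dist_eq_norm]
      exact hcl.isCompact_preimage hA
    have hFconv : Convex ℝ F := by
      intro r hr s hs a b ha hb hab
      change (a • r + b • s) • u + (y : E) ∈ A
      have h := hconv hr hs ha hb hab
      rw [show (y : E) = (a + b) • (y : E) by rw [hab, one_smul]]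
      convert h using 1
      module
    have hFne : F.Nonempty := ⟨s₀, hs₀⟩
    have hFI : F = Set.Icc (sInf F) (sSup F) :=
      eq_Icc_of_connected_compact ⟨hFne, hFconv.isPreconnected⟩ hFc
    have hle : sInf F ≤ sSup F :=
      csInf_le_csSup hFne hFc.bddBelow hFc.bddAbove
    rw [hFI, Set.Icc_add_Icc hle hab, Real.volume_Icc, Real.volume_Icc, Set.indicator_of_mem hy,
      ← ENNReal.ofReal_add (by linarith) (by linarith)]
    congr 1
    ring
  · have hFe : F = ∅ := by
      rw [Set.eq_empty_iff_forall_notMem]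
      exact fun s hs => hy (mem_projection_image_iff.2 ⟨s, hs⟩)
    rw [hFe, Set.indicator_of_notMem hy]
    simp

end Cavalieri

/-! ### Zonotopes and the unit ball -/

section Zonotopes

variable {E : Type*} [NormedAddCommGroup E] [InnerProductSpace ℝ E]

/-- The zonotope `∑ᵢ [-t ℓᵢ uᵢ, t ℓᵢ uᵢ]`, the sum running over `i ∈ s`. -/
def zonotope {ι : Type*} (u : ι → E) (l : ι → ℝ) (s : Finset ι) (t : ℝ) : Set E :=
  ∑ i ∈ s, (fun r : ℝ => r • u i) '' Set.Icc (-(t * l i)) (t * l i)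

theorem isCompact_zonotope {ι : Type*} (u : ι → E) (l : ι → ℝ) (s : Finset ι) (t : ℝ) :
    IsCompact (zonotope u l s t) := by
  classical
  unfold zonotope
  induction s using Finset.induction_on with
  | empty => exact isCompact_singleton (x := (0 : E))
  | insert j s hj ih =>
    rw [Finset.sum_insert hj]
    exact (isCompact_Icc.image (by fun_prop)).add ih

theorem convex_zonotope {ι : Type*} (u : ι → E) (l : ι → ℝ) (s : Finset ι) (t : ℝ) :
    Convex ℝ (zonotope u l s t) := by
  classical
  unfold zonotope
  induction s using Finset.induction_on with
  | empty => exact convex_singleton (0 : E)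
  | insert j s hj ih =>
    rw [Finset.sum_insert hj]
    exact ((convex_Icc _ _).linear_image (LinearMap.toSpanSingleton ℝ E (u j))).add ih

theorem mem_zonotope {ι : Type*} {u : ι → E} {l : ι → ℝ} {s : Finset ι} {t : ℝ} {x : E} :
    x ∈ zonotope u l s t ↔
      ∃ r : ι → ℝ, (∀ i ∈ s, |r i| ≤ t * l i) ∧ ∑ i ∈ s, r i • u i = x := by
  unfold zonotope
  rw [Set.mem_finsetSum]
  constructor
  · rintro ⟨g, hg, rfl⟩
    choose! r hr hrg using fun i (hi : i ∈ s) => hg hi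
    exact ⟨r, fun i hi => abs_le.2 (hr i hi), Finset.sum_congr rfl hrg⟩
  · rintro ⟨r, hr, rfl⟩
    exact ⟨fun i => r i • u i, fun {i} hi => ⟨r i, abs_le.1 (hr i hi), rfl⟩, rfl⟩

section

variable {ι : Type*} {u : ι → E} {l : ι → ℝ} {t : ℝ} {A : Set E}

theorem zonotope_insert [DecidableEq ι] {j : ι} {s : Finset ι} (hj : j ∉ s) :
    A + zonotope u l (insert j s) t =
      A + zonotope u l s t + (fun r : ℝ => r • u j) '' Set.Icc (-(t * l j)) (t * l j) := by
  unfold zonotope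
  rw [Finset.sum_insert hj, add_comm (_ '' _), add_assoc]

theorem zero_mem_zonotope (hl : ∀ i, 0 ≤ l i) (ht : 0 ≤ t) (s : Finset ι) :
    (0 : E) ∈ zonotope u l s t :=
  mem_zonotope.2 ⟨0, fun i _ => by simpa using mul_nonneg ht (hl i), by simp⟩

theorem subset_add_zonotope (hl : ∀ i, 0 ≤ l i) (ht : 0 ≤ t) (s : Finset ι) :
    A ⊆ A + zonotope u l s t := fun x hx =>
  ⟨x, hx, 0, zero_mem_zonotope hl ht s, add_zero x⟩

end

/-- A zonotope whose support function is at most that of the unit ball lies in the unit ball. -/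
theorem zonotope_subset {ι : Type*} {u : ι → E} {l : ι → ℝ} {s : Finset ι}
    (h : ∀ x : E, ∑ i ∈ s, l i * |inner ℝ (u i) x| ≤ ‖x‖) {t : ℝ} (ht : 0 ≤ t) :
    zonotope u l s t ⊆ Metric.closedBall 0 t := by
  intro x hx
  obtain ⟨r, hr, rfl⟩ := mem_zonotope.1 hx
  set x := ∑ i ∈ s, r i • u i
  rw [mem_closedBall_zero_iff]
  have h1 : ‖x‖ * ‖x‖ ≤ t * ‖x‖ := by
    calc ‖x‖ * ‖x‖ = inner ℝ x x := (real_inner_self_eq_norm_mul_norm x).symm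
      _ = ∑ i ∈ s, r i * inner ℝ (u i) x := by
        conv_lhs => rw [show inner ℝ x x = inner ℝ (∑ i ∈ s, r i • u i) x from rfl]
        rw [sum_inner]
        exact Finset.sum_congr rfl fun i _ => real_inner_smul_left _ _ _
      _ ≤ ∑ i ∈ s, t * (l i * |inner ℝ (u i) x|) := by
        refine Finset.sum_le_sum fun i hi => ?_
        calc r i * inner ℝ (u i) x ≤ |r i| * |inner ℝ (u i) x| := by
              rw [← abs_mul]; exact le_abs_self _
          _ ≤ t * l i * |inner ℝ (u i) x| := by gcongr; exact hr i hi
          _ = _ := by ring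
      _ = t * ∑ i ∈ s, l i * |inner ℝ (u i) x| := by rw [Finset.mul_sum]
      _ ≤ t * ‖x‖ := by gcongr; exact h x
  rcases (norm_nonneg x).eq_or_lt with h0 | h0
  · rw [← h0]; exact ht
  · exact le_of_mul_le_mul_right h1 h0

/-- A zonotope whose support function is at least that of the unit ball contains the unit ball. -/
theorem subset_zonotope [FiniteDimensional ℝ E] {ι : Type*} {u : ι → E} {l : ι → ℝ} {s : Finset ι}
    (hl : ∀ i, 0 ≤ l i) {c : ℝ} (h : ∀ x : E, c * ‖x‖ ≤ ∑ i ∈ s, l i * |inner ℝ (u i) x|)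
    {t : ℝ} (ht : 0 ≤ t) :
    Metric.closedBall 0 (t * c) ⊆ zonotope u l s t := by
  intro x hx
  by_contra hxz
  obtain ⟨f, q, hf, hq⟩ := geometric_hahn_banach_closed_point (convex_zonotope u l s t)
    (isCompact_zonotope u l s t).isClosed hxz
  set v := (InnerProductSpace.toDual ℝ E).symm f
  have hfv : ∀ y, f y = inner ℝ v y := fun y => by
    rw [InnerProductSpace.toDual_symm_apply]
  -- the point of the zonotope that is extreme in the direction of the separating vector `v`
  have hz : ∑ i ∈ s, (t * l i * SignType.sign (inner ℝ (u i) v)) • u i ∈ zonotope u l s t := by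
    refine mem_zonotope.2 ⟨_, fun i _ => ?_, rfl⟩
    have hti : 0 ≤ t * l i := mul_nonneg ht (hl i)
    rcases lt_trichotomy (inner ℝ (u i) v) 0 with h0 | h0 | h0 <;>
      simp [h0, abs_of_nonneg ht, abs_of_nonneg (hl i), hti]
  have h1 := hf _ hz
  have h2 : f (∑ i ∈ s, (t * l i * SignType.sign (inner ℝ (u i) v)) • u i) =
      t * ∑ i ∈ s, l i * |inner ℝ (u i) v| := by
    rw [hfv, inner_sum, Finset.mul_sum]
    refine Finset.sum_congr rfl fun i _ => ?_
    rw [real_inner_smul_right, real_inner_comm (u i) v, ← sign_mul_self (inner ℝ (u i) v)]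
    ring
  have h3 : f x ≤ ‖v‖ * (t * c) := by
    rw [hfv]
    exact (real_inner_le_norm v x).trans (by gcongr; exact mem_closedBall_zero_iff.1 hx)
  have h4 := mul_le_mul_of_nonneg_left (h v) ht
  rw [h2] at h1
  linarith

/-- The function `x ↦ |⟨v, x⟩|`, the support function of `[-v, v]`, on the unit sphere. -/
def absInner (v : E) : C(Metric.sphere (0 : E) 1, ℝ) :=
  ⟨fun x => |inner ℝ v (x : E)|, by fun_prop⟩

theorem continuous_absInner : Continuous (absInner : E → C(Metric.sphere (0 : E) 1, ℝ)) := by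
  refine ContinuousMap.continuous_of_continuous_uncurry _ ?_
  change Continuous fun p : E × Metric.sphere (0 : E) 1 => |inner ℝ p.1 (p.2 : E)|
  fun_prop

variable [FiniteDimensional ℝ E] [MeasurableSpace E] [BorelSpace E]

/-- Invariance under the reflection that interchanges `x` and `y`. -/
theorem setIntegral_abs_inner_eq {x y : E} (hxy : ‖x‖ = ‖y‖) :
    ∫ v in Metric.closedBall (0 : E) 1, |inner ℝ v x| =
      ∫ v in Metric.closedBall (0 : E) 1, |inner ℝ v y| := by
  set R := (Submodule.span ℝ {x - y})ᗮ.reflection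
  have h := R.measurePreserving.setIntegral_preimage_emb
    R.toHomeomorph.measurableEmbedding (fun v => |inner ℝ v y|) (Metric.closedBall 0 1)
  rw [← h]
  have hb : R ⁻¹' Metric.closedBall 0 1 = Metric.closedBall 0 1 := by
    rw [R.preimage_closedBall, map_zero]
  rw [hb]
  congr 1
  ext v
  rw [← Submodule.reflection_sub hxy, LinearIsometryEquiv.inner_map_map]

theorem setIntegral_abs_inner_pos {x : E} (hx : x ≠ 0) :
    0 < ∫ v in Metric.closedBall (0 : E) 1, |inner ℝ v x| := by
  have hc : Continuous fun v : E => |inner ℝ v x| := by fun_prop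
  rw [setIntegral_pos_iff_support_of_nonneg_ae (Filter.Eventually.of_forall fun v => abs_nonneg _)
    (hc.continuousOn.integrableOn_compact (isCompact_closedBall _ _))]
  have ho : IsOpen ({v : E | inner ℝ v x ≠ 0} ∩ Metric.ball 0 1) :=
    (isOpen_ne_fun (by fun_prop) continuous_const).inter Metric.isOpen_ball
  refine (ho.measure_pos volume ⟨(2 * ‖x‖)⁻¹ • x, ?_, ?_⟩).trans_le (measure_mono ?_)
  · have : ‖x‖ ≠ 0 := norm_ne_zero_iff.2 hx
    simp [real_inner_smul_left, hx]
  · have : ‖x‖ ≠ 0 := norm_ne_zero_iff.2 hx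
    rw [mem_ball_zero_iff, norm_smul, norm_inv, norm_mul, norm_norm]
    field_simp
    norm_num
  · rintro v ⟨hv, hv'⟩
    exact ⟨by simpa using hv, Metric.ball_subset_closedBall hv'⟩

/-- The unit ball is a zonoid: its support function is a uniform limit of support functions of
zonotopes. By rotation invariance the integral of `|⟨v, ·⟩|` over `v` in the unit ball is a
multiple of the norm, and an average lies in the closed convex hull of the averaged functions. -/
theorem exists_zonotope_approx [Nontrivial E] {ε : ℝ} (hε : 0 < ε) :
    ∃ (n : ℕ) (u : Fin n → E) (l : Fin n → ℝ), (∀ i, ‖u i‖ = 1) ∧ (∀ i, 0 ≤ l i) ∧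
      (∀ x : E, (1 - ε) * ‖x‖ ≤ ∑ i, l i * |inner ℝ (u i) x|) ∧
      ∀ x : E, ∑ i, l i * |inner ℝ (u i) x| ≤ ‖x‖ := by
  obtain ⟨e, he⟩ := exists_norm_eq E zero_le_one
  have he0 : e ≠ 0 := by rintro rfl; simp at he
  set B : Set E := Metric.closedBall 0 1
  have hB0 : volume B ≠ 0 := (Metric.measure_closedBall_pos volume _ one_pos).ne'
  have hBt : volume B ≠ ⊤ := (isCompact_closedBall _ _).measure_lt_top.ne
  set c : ℝ := ⨍ v in B, |inner ℝ v e| with hc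
  have hcpos : 0 < c := by
    rw [hc, setAverage_eq, smul_eq_mul]
    exact mul_pos (inv_pos.2 (ENNReal.toReal_pos hB0 hBt)) (setIntegral_abs_inner_pos he0)
  have hint : IntegrableOn (absInner : E → C(Metric.sphere (0 : E) 1, ℝ)) B :=
    continuous_absInner.continuousOn.integrableOn_compact (isCompact_closedBall _ _)
  set g : C(Metric.sphere (0 : E) 1, ℝ) := ⨍ v in B, absInner v with hg
  have hgc : ∀ x, g x = c := fun x => by
    have h := (ContinuousMap.evalCLM ℝ x : C(Metric.sphere (0 : E) 1, ℝ) →L[ℝ] ℝ).integral_comp_comm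
      hint
    have h' : g x = (ContinuousMap.evalCLM ℝ x : C(Metric.sphere (0 : E) 1, ℝ) →L[ℝ] ℝ) g := rfl
    rw [h', hg, hc, setAverage_eq, setAverage_eq, map_smul, ← h,
      setIntegral_abs_inner_eq (x := e) (y := (x : E)) (by simp [he])]
    rfl
  have hmem : g ∈ closure (convexHull ℝ (Set.range (absInner : E → _))) :=
    (convex_convexHull ℝ _).closure.set_average_mem isClosed_closure hB0 hBt
      (Filter.Eventually.of_forall fun v => subset_closure (subset_convexHull ℝ _ ⟨v, rfl⟩)) hint
  -- the error for which `(c - δ) / (c + δ) ≥ 1 - ε`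
  set δ : ℝ := c * ε / 2 with hδ
  have hδpos : 0 < δ := by positivity
  obtain ⟨f, hf, hfg⟩ := Metric.mem_closure_iff.1 hmem δ hδpos
  obtain ⟨ι, _, w, z, hw, -, hz, rfl⟩ := mem_convexHull_iff_exists_fintype.1 hf
  choose v hv using hz
  -- pass from the vectors `v` to unit vectors and nonnegative lengths
  have hunit : ∀ y : E, ∃ u : E, ‖u‖ = 1 ∧ y = ‖y‖ • u := fun y => by
    by_cases hy : y = 0
    · exact ⟨e, he, by simp [hy]⟩
    · have : ‖y‖ ≠ 0 := norm_ne_zero_iff.2 hy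
      refine ⟨‖y‖⁻¹ • y, ?_, ?_⟩
      · rw [norm_smul, norm_inv, norm_norm, inv_mul_cancel₀ this]
      · rw [smul_smul, mul_inv_cancel₀ this, one_smul]
  choose u hu1 hu using hunit
  have key : ∀ x : Metric.sphere (0 : E) 1,
      |∑ i, w i * ‖v i‖ * |inner ℝ (u (v i)) (x : E)| - c| < δ := fun x => by
    have h := (ContinuousMap.dist_apply_le_dist x).trans_lt hfg
    rw [hgc, dist_comm, Real.dist_eq, ContinuousMap.sum_apply] at h
    refine lt_of_eq_of_lt ?_ h
    congr 2
    refine Finset.sum_congr rfl fun i _ => ?_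
    rw [ContinuousMap.smul_apply, ← hv i, smul_eq_mul, mul_assoc]
    congr 1
    change _ = |inner ℝ (v i) (x : E)|
    conv_rhs => rw [hu (v i)]
    rw [real_inner_smul_left, abs_mul, abs_norm]
  have hsum : ∀ x : E, (c - δ) * ‖x‖ ≤ ∑ i, w i * ‖v i‖ * |inner ℝ (u (v i)) x| ∧
      ∑ i, w i * ‖v i‖ * |inner ℝ (u (v i)) x| ≤ (c + δ) * ‖x‖ := fun x => by
    have hs : ∑ i, w i * ‖v i‖ * |inner ℝ (u (v i)) x| =
        (∑ i, w i * ‖v i‖ * |inner ℝ (u (v i)) (u x)|) * ‖x‖ := by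
      rw [Finset.sum_mul]
      refine Finset.sum_congr rfl fun i _ => ?_
      conv_lhs => rw [hu x]
      rw [real_inner_smul_right, abs_mul, abs_norm]
      ring
    have hk := abs_lt.1 (key ⟨u x, by simp [hu1]⟩)
    simp only at hk
    rw [hs]
    constructor <;> gcongr <;> linarith
  have hcδ : 0 < c + δ := by positivity
  let σ := (Fintype.equivFin ι).symm
  have hre : ∀ x : E, ∑ i, (c + δ)⁻¹ * (w (σ i) * ‖v (σ i)‖) * |inner ℝ (u (v (σ i))) x| =
      (c + δ)⁻¹ * ∑ i, w i * ‖v i‖ * |inner ℝ (u (v i)) x| := fun x => by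
    rw [σ.sum_comp fun i => (c + δ)⁻¹ * (w i * ‖v i‖) * |inner ℝ (u (v i)) x|, Finset.mul_sum]
    exact Finset.sum_congr rfl fun i _ => by ring
  refine ⟨Fintype.card ι, fun i => u (v (σ i)), fun i => (c + δ)⁻¹ * (w (σ i) * ‖v (σ i)‖),
    fun i => hu1 _, fun i => ?_, fun x => ?_, fun x => ?_⟩
  · have := hw (σ i)
    positivity
  · rw [hre, ← div_eq_inv_mul, le_div_iff₀ hcδ]
    refine le_trans ?_ (hsum x).1
    have : (1 - ε) * (c + δ) ≤ c - δ := by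
      rw [hδ]; nlinarith [sq_nonneg ε]
    nlinarith [norm_nonneg x]
  · rw [hre, ← div_eq_inv_mul, div_le_iff₀ hcδ, mul_comm ‖x‖]
    exact (hsum x).2

end Zonotopes

/-! ### The volume of parallel bodies -/

section ParallelBodies

variable {E : Type*} [NormedAddCommGroup E] [InnerProductSpace ℝ E] [FiniteDimensional ℝ E]
  [MeasurableSpace E] [BorelSpace E]

/-- The volume of the orthogonal projection of a set along the line spanned by `u`. -/
noncomputable def shadow (A : Set E) (u : E) : ℝ :=
  (volume : Measure (Submodule.span ℝ {u})ᗮ).real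
    ((Submodule.span ℝ {u})ᗮ.orthogonalProjectionOnto '' A)

theorem shadow_mono {A C : Set E} (h : A ⊆ C) (hC : IsCompact C) (u : E) :
    shadow A u ≤ shadow C u :=
  measureReal_mono (Set.image_mono h) (isCompact_projection_image hC).measure_lt_top.ne

theorem volume_real_add_segment {u : E} (hu : ‖u‖ = 1) {A : Set E} (hA : IsCompact A)
    (hconv : Convex ℝ A) {a : ℝ} (ha : 0 ≤ a) :
    volume.real (A + (fun s : ℝ => s • u) '' Set.Icc (-a) a) =
      volume.real A + 2 * a * shadow A u := by
  have h := volume_add_segment hu hA hconv (show -a ≤ a by linarith)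
  have hA' := hA.measure_lt_top (μ := volume).ne
  have hP' := (isCompact_projection_image (u := u) hA).measure_lt_top (μ := volume).ne
  rw [measureReal_def, h, ENNReal.toReal_add hA' (ENNReal.mul_ne_top ENNReal.ofReal_ne_top hP'),
    ENNReal.toReal_mul, ENNReal.toReal_ofReal (by linarith), shadow, measureReal_def,
    measureReal_def]
  ring

section

variable {ι : Type*} {u : ι → E} {l : ι → ℝ} {t : ℝ} {A : Set E}

/-- Adding the segments one at a time, each step gains at least what it would gain from `A`. -/
theorem le_volume_add_zonotope (hu : ∀ i, ‖u i‖ = 1) (hl : ∀ i, 0 ≤ l i) (ht : 0 ≤ t)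
    (hA : IsCompact A) (hconv : Convex ℝ A) (s : Finset ι) :
    volume.real A + ∑ i ∈ s, 2 * (t * l i) * shadow A (u i) ≤
      volume.real (A + zonotope u l s t) := by
  classical
  induction s using Finset.induction_on with
  | empty => simp [zonotope]
  | insert j s hj ih =>
    have hlj := mul_nonneg ht (hl j)
    have hc := hA.add (isCompact_zonotope u l s t)
    rw [zonotope_insert hj, volume_real_add_segment (hu j) hc
      (hconv.add (convex_zonotope u l s t)) hlj, Finset.sum_insert hj]
    have := mul_le_mul_of_nonneg_left
      (shadow_mono (subset_add_zonotope (u := u) hl ht s) hc (u j))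
      (by linarith : 0 ≤ 2 * (t * l j))
    linarith

/-- Adding the segments one at a time, each step gains at most what it would gain from a set `C`
that contains the final sum. -/
theorem volume_add_zonotope_le (hu : ∀ i, ‖u i‖ = 1) (hl : ∀ i, 0 ≤ l i) (ht : 0 ≤ t)
    (hA : IsCompact A) (hconv : Convex ℝ A) {C : Set E} (hC : IsCompact C) (s : Finset ι)
    (hs : A + zonotope u l s t ⊆ C) :
    volume.real (A + zonotope u l s t) ≤
      volume.real A + ∑ i ∈ s, 2 * (t * l i) * shadow C (u i) := by
  classical
  induction s using Finset.induction_on with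
  | empty => simp [zonotope]
  | insert j s hj ih =>
    have hlj := mul_nonneg ht (hl j)
    have hc := hA.add (isCompact_zonotope u l s t)
    have hsub : A + zonotope u l s t ⊆ C := by
      refine Set.Subset.trans (fun x hx => ?_) hs
      rw [zonotope_insert hj]
      exact ⟨x, hx, 0, ⟨0, ⟨by linarith, hlj⟩, zero_smul ℝ _⟩, add_zero x⟩
    rw [zonotope_insert hj, volume_real_add_segment (hu j) hc
      (hconv.add (convex_zonotope u l s t)) hlj, Finset.sum_insert hj]
    have := mul_le_mul_of_nonneg_left (shadow_mono hsub hC (u j))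
      (by linarith : 0 ≤ 2 * (t * l j))
    have := ih hsub
    linarith

end

/-- Projections of parallel bodies shrink to the projection of the body. -/
theorem eventually_shadow_add_closedBall_le {A : Set E} (hA : IsCompact A) (u : E) {δ : ℝ}
    (hδ : 0 < δ) :
    ∀ᶠ t in 𝓝[>] (0 : ℝ), shadow (A + Metric.closedBall 0 t) u ≤ shadow A u + δ := by
  set P := (Submodule.span ℝ {u})ᗮ.orthogonalProjectionOnto
  have hP : IsCompact (P '' A) := isCompact_projection_image hA
  have h := (ENNReal.tendsto_toReal hP.measure_lt_top.ne).comp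
    (tendsto_measure_cthickening_of_isCompact (μ := volume) hP)
  have h' := (h.eventually (ge_mem_nhds (lt_add_of_pos_right _ hδ))).filter_mono
    (nhdsWithin_le_nhds (s := Set.Ioi 0))
  filter_upwards [h', self_mem_nhdsWithin] with t ht ht0
  refine le_trans ?_ ht
  refine measureReal_mono ?_ hP.cthickening.measure_lt_top.ne
  rintro _ ⟨_, ⟨x, hx, y, hy, rfl⟩, rfl⟩
  refine Metric.mem_cthickening_of_dist_le _ (P x) _ _ ⟨x, hx, rfl⟩ ?_
  rw [map_add, dist_eq_norm, add_sub_cancel_left]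
  exact (Submodule.norm_orthogonalProjectionOnto_apply_le _ y).trans (mem_closedBall_zero_iff.1 hy)

/-- If a zonotope approximates the unit ball up to the factor `1 - ε`, then the volume of the
parallel bodies of a convex body of constant brightness `b` grows, to first order, at a rate
between `b` and `b / (1 - ε)` times the total length of the segments of the zonotope. -/
theorem volume_parallel_bounds {n : ℕ} {u : Fin n → E} {l : Fin n → ℝ} (hu : ∀ i, ‖u i‖ = 1)
    (hl : ∀ i, 0 ≤ l i) {ε : ℝ} (hε1 : ε < 1)
    (hlow : ∀ x : E, (1 - ε) * ‖x‖ ≤ ∑ i, l i * |inner ℝ (u i) x|)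
    (hupp : ∀ x : E, ∑ i, l i * |inner ℝ (u i) x| ≤ ‖x‖)
    {A : Set E} (hA : IsCompact A) (hconv : Convex ℝ A) {b : ℝ}
    (hb : ∀ v : E, ‖v‖ = 1 → shadow A v = b) :
    (∀ t, 0 ≤ t → volume.real A + t * ((∑ i, 2 * l i) * b) ≤
      volume.real (A + Metric.closedBall 0 t)) ∧
    ∀ δ, 0 < δ → ∀ᶠ t in 𝓝[>] (0 : ℝ), volume.real (A + Metric.closedBall 0 t) ≤
      volume.real A + t * ((∑ i, 2 * l i) * (b + δ) / (1 - ε)) := by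
  have hε' : 0 < 1 - ε := by linarith
  constructor
  · intro t ht
    refine le_trans (le_of_eq ?_) ((le_volume_add_zonotope hu hl ht hA hconv Finset.univ).trans
      (measureReal_mono (Set.add_subset_add_left (zonotope_subset hupp ht))
        (hA.add (isCompact_closedBall _ _)).measure_lt_top.ne))
    rw [Finset.sum_mul, Finset.mul_sum]
    congr 1
    refine Finset.sum_congr rfl fun i _ => ?_
    rw [hb _ (hu i)]
    ring
  · intro δ hδ
    have h : ∀ᶠ t in 𝓝[>] (0 : ℝ), ∀ i, shadow (A + Metric.closedBall 0 t) (u i) ≤ b + δ := by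
      rw [eventually_all]
      intro i
      rw [← hb _ (hu i)]
      exact eventually_shadow_add_closedBall_le hA (u i) hδ
    have hscale : Tendsto (fun t : ℝ => t / (1 - ε)) (𝓝[>] 0) (𝓝[>] 0) := by
      refine tendsto_nhdsWithin_iff.2 ⟨?_, ?_⟩
      · have : Tendsto (fun t : ℝ => t / (1 - ε)) (𝓝 0) (𝓝 (0 / (1 - ε))) :=
          tendsto_id.div_const _
        rw [zero_div] at this
        exact this.mono_left nhdsWithin_le_nhds
      · filter_upwards [self_mem_nhdsWithin] with t ht
        exact div_pos ht hε'
    filter_upwards [hscale.eventually h, self_mem_nhdsWithin] with t ht ht0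
    set r := t / (1 - ε)
    have hr : 0 ≤ r := (div_pos ht0 hε').le
    have htr : t = r * (1 - ε) := (div_mul_cancel₀ t hε'.ne').symm
    have hsub : Metric.closedBall (0 : E) t ⊆ zonotope u l Finset.univ r := by
      rw [htr]
      exact subset_zonotope hl hlow hr
    have hC : IsCompact (A + Metric.closedBall (0 : E) r) := hA.add (isCompact_closedBall _ _)
    calc volume.real (A + Metric.closedBall 0 t)
        ≤ volume.real (A + zonotope u l Finset.univ r) :=
          measureReal_mono (Set.add_subset_add_left hsub)
            (hA.add (isCompact_zonotope u l _ r)).measure_lt_top.ne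
      _ ≤ volume.real A + ∑ i, 2 * (r * l i) * shadow (A + Metric.closedBall 0 r) (u i) :=
          volume_add_zonotope_le hu hl hr hA hconv hC _
            (Set.add_subset_add_left (zonotope_subset hupp hr))
      _ ≤ volume.real A + ∑ i, 2 * (r * l i) * (b + δ) := by
          gcongr with i _
          · have := hl i
            positivity
          · exact ht i
      _ = _ := by
          rw [← Finset.sum_mul, Finset.sum_mul, Finset.sum_mul, Finset.sum_div, Finset.mul_sum]
          congr 1
          refine Finset.sum_congr rfl fun i _ => ?_
          simp only [r]
          ring

/-- Two convex bodies of constant brightness have surface areas proportional to their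
brightnesses. Stated for a reference body `C` whose surface area `σ` is known to exist; the
common total length of the segments of an approximating zonotope is eliminated. -/
theorem hasDerivWithinAt_volume_parallel [Nontrivial E] {C : Set E} (hC : IsCompact C)
    (hCconv : Convex ℝ C) {c σ : ℝ} (hc0 : 0 < c) (hc : ∀ v : E, ‖v‖ = 1 → shadow C v = c)
    (hσ : HasDerivWithinAt (fun t : ℝ => volume.real (C + Metric.closedBall 0 t)) σ (Set.Ici 0) 0)
    {A : Set E} (hA : IsCompact A) (hconv : Convex ℝ A) {b : ℝ} (hb0 : 0 ≤ b)
    (hb : ∀ v : E, ‖v‖ = 1 → shadow A v = b) :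
    HasDerivWithinAt (fun t : ℝ => volume.real (A + Metric.closedBall 0 t)) (σ / c * b)
      (Set.Ici 0) 0 := by
  rw [← hasDerivWithinAt_Ioi_iff_Ici,
    hasDerivWithinAt_iff_tendsto_slope' Set.self_notMem_Ioi] at hσ ⊢
  have hslope : ∀ (D : Set E) (t : ℝ), slope (fun t : ℝ => volume.real (D + Metric.closedBall 0 t))
      0 t = (volume.real (D + Metric.closedBall 0 t) - volume.real D) / t := fun D t => by
    simp [slope_def_field, Metric.closedBall_zero]
  simp only [funext (hslope _)] at hσ ⊢
  set m := σ / c with hm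
  -- bounds on the total length of an approximating zonotope, from the reference body
  have key : ∀ ε ∈ Set.Ioo (0 : ℝ) 1,
      (∀ t, 0 < t → (1 - ε) * m * b ≤
        (volume.real (A + Metric.closedBall 0 t) - volume.real A) / t) ∧
      ∀ᶠ t in 𝓝[>] (0 : ℝ), (volume.real (A + Metric.closedBall 0 t) - volume.real A) / t ≤
        m * (b + ε) / (1 - ε) := by
    rintro ε ⟨hε, hε1⟩
    have hε' : 0 < 1 - ε := by linarith
    obtain ⟨n, u, l, hu, hl, hlow, hupp⟩ := exists_zonotope_approx (E := E) hε
    obtain ⟨hC1, hC2⟩ := volume_parallel_bounds hu hl hε1 hlow hupp hC hCconv hc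
    obtain ⟨hA1, hA2⟩ := volume_parallel_bounds hu hl hε1 hlow hupp hA hconv hb
    set W := ∑ i, 2 * l i with hW
    have hW0 : 0 ≤ W := Finset.sum_nonneg fun i _ => mul_nonneg zero_le_two (hl i)
    have hWm : W ≤ m := by
      rw [hm, le_div_iff₀ hc0]
      refine ge_of_tendsto hσ ?_
      filter_upwards [self_mem_nhdsWithin] with t ht
      rw [le_div_iff₀ ht]
      linarith [hC1 t (le_of_lt ht)]
    have hmW : (1 - ε) * m ≤ W := by
      have h1 : ∀ δ, 0 < δ → σ ≤ W * (c + δ) / (1 - ε) := fun δ hδ => by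
        refine le_of_tendsto hσ ?_
        filter_upwards [self_mem_nhdsWithin, hC2 δ hδ] with t ht ht2
        rw [div_le_iff₀ ht]
        linarith
      have h2 : σ ≤ W * (c + 0) / (1 - ε) := by
        have h3 : Tendsto (fun δ : ℝ => W * (c + δ) / (1 - ε)) (𝓝[>] 0)
            (𝓝 (W * (c + 0) / (1 - ε))) := by
          refine Tendsto.mono_left (Continuous.tendsto (by fun_prop) 0) nhdsWithin_le_nhds
        refine ge_of_tendsto h3 ?_
        filter_upwards [self_mem_nhdsWithin] with δ hδ using h1 δ hδ
      rw [add_zero, le_div_iff₀ hε'] at h2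
      rw [hm, mul_div_assoc', div_le_iff₀ hc0]
      linarith
    constructor
    · intro t ht
      rw [le_div_iff₀ ht]
      have h1 := hA1 t ht.le
      have h2 : (1 - ε) * m * b * t ≤ W * b * t := by gcongr
      linarith
    · filter_upwards [hA2 ε hε, self_mem_nhdsWithin] with t ht ht0
      rw [div_le_iff₀ ht0]
      have h2 : t * (W * (b + ε) / (1 - ε)) ≤ t * (m * (b + ε) / (1 - ε)) := by
        have : (0 : ℝ) ≤ t := le_of_lt ht0
        gcongr
      linarith
  have hIoo : Set.Ioo (0 : ℝ) 1 ∈ 𝓝[>] (0 : ℝ) := Ioo_mem_nhdsGT one_pos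
  refine tendsto_order.2 ⟨fun a ha => ?_, fun a ha => ?_⟩
  · have h3 : Tendsto (fun ε : ℝ => (1 - ε) * m * b) (𝓝[>] 0) (𝓝 ((1 - 0) * m * b)) :=
      Tendsto.mono_left (Continuous.tendsto (by fun_prop) 0) nhdsWithin_le_nhds
    rw [sub_zero, one_mul] at h3
    obtain ⟨ε, h1, h2⟩ := ((h3.eventually (lt_mem_nhds ha)).and hIoo).exists
    filter_upwards [self_mem_nhdsWithin] with t ht
    exact h1.trans_le ((key ε h2).1 t ht)
  · have h3 : Tendsto (fun ε : ℝ => m * (b + ε) / (1 - ε)) (𝓝[>] 0)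
        (𝓝 (m * (b + 0) / (1 - 0))) := by
      refine Tendsto.mono_left (ContinuousAt.tendsto ?_) nhdsWithin_le_nhds
      exact ContinuousAt.div (by fun_prop) (by fun_prop) (by norm_num)
    rw [sub_zero, add_zero, div_one] at h3
    obtain ⟨ε, h1, h2⟩ := ((h3.eventually (gt_mem_nhds ha)).and hIoo).exists
    filter_upwards [(key ε h2).2] with t ht
    exact ht.trans_lt h1

end ParallelBodies

variable {d : ℕ}

/-! ### Lines meeting a convex body -/

/-- The set of lines that meet `A`. -/
def hits (A : Set (EuclideanSpace ℝ (Fin d))) : Set (Line d) :=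
  {L | ((L.carrier : Set (EuclideanSpace ℝ (Fin d))) ∩ A).Nonempty}

theorem Line.translate_through (x : EuclideanSpace ℝ (Fin d))
    (p : Metric.sphere (0 : EuclideanSpace ℝ (Fin d)) 1 × EuclideanSpace ℝ (Fin d)) :
    (Line.through p).translate x = Line.through (p.1, x + p.2) := by
  apply Line.ext
  apply SetLike.coe_injective
  ext z
  change z ∈ ((x +ᵥ (Line.through p).carrier : AffineSubspace ℝ _) : Set _) ↔ _
  rw [AffineSubspace.coe_pointwise_vadd, Set.mem_vadd_set_iff_neg_vadd_mem]
  change -x +ᵥ z ∈ AffineSubspace.mk' p.2 _ ↔ z ∈ AffineSubspace.mk' (x + p.2) _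
  rw [AffineSubspace.mem_mk', AffineSubspace.mem_mk']
  simp only [vsub_eq_sub, vadd_eq_add]
  rw [show -x + z - p.2 = z - (x + p.2) by abel]

theorem Line.translate_translate (x y : EuclideanSpace ℝ (Fin d)) (L : Line d) :
    (L.translate x).translate y = L.translate (y + x) := by
  obtain ⟨p, rfl⟩ := Line.isOpenQuotientMap_through.surjective L
  simp only [Line.translate_through, add_assoc]

theorem Line.translate_zero (L : Line d) : L.translate 0 = L := by
  obtain ⟨p, rfl⟩ := Line.isOpenQuotientMap_through.surjective L
  rw [Line.translate_through, zero_add]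

theorem Line.continuous_translate :
    Continuous fun p : EuclideanSpace ℝ (Fin d) × Line d => p.2.translate p.1 := by
  rw [← (IsOpenQuotientMap.id.prodMap Line.isOpenQuotientMap_through).continuous_comp_iff]
  have : (fun p : EuclideanSpace ℝ (Fin d) × Line d => p.2.translate p.1) ∘
      Prod.map id Line.through = fun p => Line.through (p.2.1, p.1 + p.2.2) := by
    ext1 p
    exact Line.translate_through p.1 p.2
  rw [this]
  exact Line.isOpenQuotientMap_through.continuous.comp (by fun_prop)

theorem through_mem_hits_iff {A : Set (EuclideanSpace ℝ (Fin d))}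
    {p : Metric.sphere (0 : EuclideanSpace ℝ (Fin d)) 1 × EuclideanSpace ℝ (Fin d)} :
    Line.through p ∈ hits A ↔
      (Submodule.span ℝ {(p.1 : EuclideanSpace ℝ (Fin d))})ᗮ.orthogonalProjectionOnto p.2 ∈
        (Submodule.span ℝ {(p.1 : EuclideanSpace ℝ (Fin d))})ᗮ.orthogonalProjectionOnto '' A := by
  set P := (Submodule.span ℝ {(p.1 : EuclideanSpace ℝ (Fin d))})ᗮ.orthogonalProjectionOnto
  have hker : ∀ z, z -ᵥ p.2 ∈ Submodule.span ℝ {(p.1 : EuclideanSpace ℝ (Fin d))} ↔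
      P z = P p.2 := fun z => by
    rw [← sub_eq_zero, ← map_sub, Submodule.orthogonalProjectionOnto_eq_zero_iff,
      Submodule.orthogonal_orthogonal]
    rfl
  constructor
  · rintro ⟨z, hz, hzA⟩
    exact ⟨z, hzA, (hker z).1 (AffineSubspace.mem_mk'.1 hz)⟩
  · rintro ⟨z, hzA, hz⟩
    exact ⟨z, AffineSubspace.mem_mk'.2 ((hker z).2 hz), hzA⟩

theorem isClosed_hits {A : Set (EuclideanSpace ℝ (Fin d))} (hA : IsCompact A) :
    IsClosed (hits A) := by
  rw [← Line.isOpenQuotientMap_through.isQuotientMap.isClosed_preimage]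
  have : CompactSpace A := isCompact_iff_compactSpace.1 hA
  have hC : IsClosed {q : (Metric.sphere (0 : EuclideanSpace ℝ (Fin d)) 1 ×
      EuclideanSpace ℝ (Fin d)) × A | (q.2 : EuclideanSpace ℝ (Fin d)) - q.1.2 =
        inner ℝ (q.1.1 : EuclideanSpace ℝ (Fin d)) ((q.2 : EuclideanSpace ℝ (Fin d)) - q.1.2) •
          (q.1.1 : EuclideanSpace ℝ (Fin d))} :=
    isClosed_eq (by fun_prop) (by fun_prop)
  convert isClosedMap_fst_of_compactSpace _ hC using 1
  ext p
  constructor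
  · rintro ⟨z, hz, hzA⟩
    obtain ⟨s, hs⟩ := Submodule.mem_span_singleton.1 (AffineSubspace.mem_mk'.1 hz)
    refine ⟨(p, ⟨z, hzA⟩), ?_, rfl⟩
    change z - p.2 = inner ℝ (p.1 : EuclideanSpace ℝ (Fin d)) (z - p.2) • _
    rw [vsub_eq_sub] at hs
    rw [← hs, real_inner_smul_right, real_inner_self_eq_norm_sq]
    simp
  · rintro ⟨⟨_, z⟩, hq, rfl⟩
    exact ⟨z, AffineSubspace.mem_mk'.2 (Submodule.mem_span_singleton.2 ⟨_, hq.symm⟩), z.2⟩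

theorem isCompact_hits {A : Set (EuclideanSpace ℝ (Fin d))} (hA : IsCompact A) :
    IsCompact (hits A) := by
  have h : hits A = Line.through '' (Set.univ ×ˢ A) := by
    ext L
    constructor
    · rintro ⟨z, hz, hzA⟩
      obtain ⟨p, rfl⟩ := Line.isOpenQuotientMap_through.surjective L
      refine ⟨(p.1, z), ⟨trivial, hzA⟩, Line.through_eq_iff.2 ⟨Or.inl rfl, ?_⟩⟩
      obtain ⟨s, hs⟩ := Submodule.mem_span_singleton.1 (AffineSubspace.mem_mk'.1 hz)
      refine ⟨-s, ?_⟩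
      simp only
      rw [neg_smul, hs, vsub_eq_sub]
      abel
    · rintro ⟨p, ⟨-, hp⟩, rfl⟩
      exact ⟨p.2, AffineSubspace.self_mem_mk' _ _, hp⟩
  rw [h]
  exact (isCompact_univ.prod hA).image Line.isOpenQuotientMap_through.continuous

/-- The slab of width one around the origin, perpendicular to the line `L`. -/
def slab (L : Line d) : Set (EuclideanSpace ℝ (Fin d)) :=
  {x | ∀ u ∈ L.carrier.direction, ‖u‖ = 1 → |inner ℝ u x| ≤ 1 / 2}

theorem mem_slab_through {x : EuclideanSpace ℝ (Fin d)}
    {p : Metric.sphere (0 : EuclideanSpace ℝ (Fin d)) 1 × EuclideanSpace ℝ (Fin d)} :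
    x ∈ slab (Line.through p) ↔ |inner ℝ (p.1 : EuclideanSpace ℝ (Fin d)) x| ≤ 1 / 2 := by
  have hp : ‖(p.1 : EuclideanSpace ℝ (Fin d))‖ = 1 := by simp
  have hd : (Line.through p).carrier.direction =
      Submodule.span ℝ {(p.1 : EuclideanSpace ℝ (Fin d))} := AffineSubspace.direction_mk' _ _
  simp only [slab, Set.mem_ofPred_eq, hd]
  constructor
  · exact fun h => h _ (Submodule.mem_span_singleton_self _) hp
  · intro h u hu hu1
    obtain ⟨a, rfl⟩ := Submodule.mem_span_singleton.1 hu
    rw [norm_smul, hp, mul_one, Real.norm_eq_abs] at hu1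
    rw [real_inner_smul_left, abs_mul, hu1, one_mul]
    exact h

theorem neg_mem_slab {x : EuclideanSpace ℝ (Fin d)} {L : Line d} : -x ∈ slab L ↔ x ∈ slab L := by
  simp [slab]

theorem slab_translate (x : EuclideanSpace ℝ (Fin d)) (L : Line d) :
    slab (L.translate x) = slab L := by
  obtain ⟨p, rfl⟩ := Line.isOpenQuotientMap_through.surjective L
  ext y
  rw [Line.translate_through, mem_slab_through, mem_slab_through]

theorem isClosed_setOf_mem_slab :
    IsClosed {q : Line d × EuclideanSpace ℝ (Fin d) | q.2 ∈ slab q.1} := by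
  rw [← (Line.isOpenQuotientMap_through.prodMap
    IsOpenQuotientMap.id).isQuotientMap.isClosed_preimage]
  have h : Prod.map Line.through id ⁻¹'
      {q : Line d × EuclideanSpace ℝ (Fin d) | q.2 ∈ slab q.1} =
      {q : (Metric.sphere (0 : EuclideanSpace ℝ (Fin d)) 1 × EuclideanSpace ℝ (Fin d)) ×
        EuclideanSpace ℝ (Fin d) | |inner ℝ (q.1.1 : EuclideanSpace ℝ (Fin d)) q.2| ≤ 1 / 2} := by
    ext q
    exact mem_slab_through
  rw [h]
  exact isClosed_le (by fun_prop) continuous_const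

/-- The translations in the slab of `L` that carry `L` to a line meeting `A` form a set whose
volume is that of the projection of `A` along `L`. -/
theorem volume_slab_translate_mem_hits {A : Set (EuclideanSpace ℝ (Fin d))} (hA : IsCompact A)
    (p : Metric.sphere (0 : EuclideanSpace ℝ (Fin d)) 1 × EuclideanSpace ℝ (Fin d)) :
    volume {x | x ∈ slab (Line.through p) ∧ (Line.through p).translate x ∈ hits A} =
      volume ((Submodule.span ℝ {(p.1 : EuclideanSpace ℝ (Fin d))})ᗮ.orthogonalProjectionOnto ''
        A) := by
  set P := (Submodule.span ℝ {(p.1 : EuclideanSpace ℝ (Fin d))})ᗮ.orthogonalProjectionOnto with hP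
  have hm : MeasurableSet ((fun y => y + P p.2) ⁻¹' (P '' A)) :=
    (isCompact_projection_image hA).measurableSet.preimage (by fun_prop)
  rw [← measure_preimage_add_right volume (P p.2) (P '' A),
    ← volume_slab_inter_cylinder (by simp) hm]
  congr 1
  ext x
  simp only [Set.mem_ofPred_eq, mem_slab_through, Line.translate_through, through_mem_hits_iff,
    Set.mem_preimage, map_add, hP]

/-- `A` has the constant brightness `a`, for sets and with values in `[0, ∞]`. -/
def BrightnessEq (A : Set (EuclideanSpace ℝ (Fin d))) (a : ℝ≥0∞) : Prop :=
  ∀ u : EuclideanSpace ℝ (Fin d), ‖u‖ = 1 →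
    volume ((Submodule.span ℝ {u})ᗮ.orthogonalProjectionOnto '' A) = a

theorem BrightnessEq.volume_slab {A : Set (EuclideanSpace ℝ (Fin d))} {a : ℝ≥0∞}
    (h : BrightnessEq A a) (hA : IsCompact A) (L : Line d) :
    volume {x | x ∈ slab L ∧ L.translate x ∈ hits A} = a := by
  obtain ⟨p, rfl⟩ := Line.isOpenQuotientMap_through.surjective L
  rw [volume_slab_translate_mem_hits hA, h _ (by simp)]

/-- For a measure on pairs of lines that is invariant under translations of the first line, the
measure of the pairs whose first line meets a body `A` of constant brightness is proportional to
the brightness. This is a mass transport argument: the set of triples `(L₁, L₂, x)` such that `L₁`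
meets `A`, `L₁ + x` meets `C` and `x` lies in the slab of `L₁` is measured in two ways,
integrating over `x` first and, after the substitution of `L₁ + x` for `L₁`, last. -/
theorem brightness_mul_measure_hits {Θ : Measure (Line d × Line d)} [SFinite Θ]
    (hinv : ∀ x : EuclideanSpace ℝ (Fin d), ∀ B : Set (Line d × Line d), MeasurableSet B →
      Θ ((fun G : Line d × Line d => (G.1.translate x, G.2)) ⁻¹' B) = Θ B)
    {A C : Set (EuclideanSpace ℝ (Fin d))} (hA : IsCompact A) (hC : IsCompact C) {a c : ℝ≥0∞}
    (ha : BrightnessEq A a) (hc : BrightnessEq C c) {D : Set (Line d)} (hD : MeasurableSet D) :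
    c * Θ (hits A ×ˢ D) = a * Θ (hits C ×ˢ D) := by
  have hA' := (isClosed_hits hA).measurableSet
  have hC' := (isClosed_hits hC).measurableSet
  have hslab : MeasurableSet {q : (Line d × Line d) × EuclideanSpace ℝ (Fin d) |
      q.2 ∈ slab q.1.1} :=
    (isClosed_setOf_mem_slab.preimage
      (f := fun q : (Line d × Line d) × EuclideanSpace ℝ (Fin d) => (q.1.1, q.2))
      (by fun_prop)).measurableSet
  have htr : Measurable fun q : (Line d × Line d) × EuclideanSpace ℝ (Fin d) =>
      q.1.1.translate q.2 :=
    (Line.continuous_translate.comp (f := fun q : (Line d × Line d) × EuclideanSpace ℝ (Fin d) =>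
      (q.2, q.1.1)) (by fun_prop)).measurable
  have htr' : Measurable fun q : (Line d × Line d) × EuclideanSpace ℝ (Fin d) =>
      q.1.1.translate (-q.2) :=
    (Line.continuous_translate.comp (f := fun q : (Line d × Line d) × EuclideanSpace ℝ (Fin d) =>
      (-q.2, q.1.1)) (by fun_prop)).measurable
  set M : Set ((Line d × Line d) × EuclideanSpace ℝ (Fin d)) :=
    {q | q.1 ∈ hits A ×ˢ D ∧ q.2 ∈ slab q.1.1 ∧ q.1.1.translate q.2 ∈ hits C} with hM
  set N : Set ((Line d × Line d) × EuclideanSpace ℝ (Fin d)) :=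
    {q | q.1 ∈ hits C ×ˢ D ∧ q.2 ∈ slab q.1.1 ∧ q.1.1.translate (-q.2) ∈ hits A} with hN
  have hMm : MeasurableSet M :=
    ((hA'.prod hD).preimage measurable_fst).inter (hslab.inter (htr hC'))
  have hNm : MeasurableSet N :=
    ((hC'.prod hD).preimage measurable_fst).inter (hslab.inter (htr' hA'))
  have hMvol : (Θ.prod volume) M = c * Θ (hits A ×ˢ D) := by
    rw [Measure.prod_apply hMm, ← lintegral_indicator_const (hA'.prod hD)]
    congr 1
    ext G
    by_cases hG : G ∈ hits A ×ˢ D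
    · rw [Set.indicator_of_mem hG, ← hc.volume_slab hC G.1]
      congr 1
      ext x
      simp only [hM, Set.mem_preimage, Set.mem_ofPred_eq, hG, true_and]
    · rw [Set.indicator_of_notMem hG]
      convert measure_empty (μ := (volume : Measure (EuclideanSpace ℝ (Fin d))))
      ext x
      simp only [hM, Set.mem_preimage, Set.mem_ofPred_eq, hG, false_and, Set.mem_empty_iff_false]
  have hNvol : (Θ.prod volume) N = a * Θ (hits C ×ˢ D) := by
    rw [Measure.prod_apply hNm, ← lintegral_indicator_const (hC'.prod hD)]
    congr 1
    ext G
    by_cases hG : G ∈ hits C ×ˢ D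
    · rw [Set.indicator_of_mem hG, ← ha.volume_slab hA G.1, ← Measure.measure_neg]
      congr 1
      ext x
      simp only [hN, Set.mem_preimage, Set.mem_ofPred_eq, hG, true_and, Set.mem_neg,
        neg_mem_slab, neg_neg]
    · rw [Set.indicator_of_notMem hG]
      convert measure_empty (μ := (volume : Measure (EuclideanSpace ℝ (Fin d))))
      ext x
      simp only [hN, Set.mem_preimage, Set.mem_ofPred_eq, hG, false_and, Set.mem_empty_iff_false]
  rw [← hMvol, ← hNvol, Measure.prod_apply_symm hMm, Measure.prod_apply_symm hNm]
  congr 1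
  ext x
  rw [← hinv x _ (hNm.preimage (by fun_prop))]
  congr 1
  ext G
  simp only [hM, hN, Set.mem_preimage, Set.mem_ofPred_eq, Set.mem_prod, slab_translate,
    Line.translate_translate, neg_add_cancel, Line.translate_zero]
  tauto

theorem SeparatelyTranslationInvariant.measure_preimage {Θ : Measure (Line d × Line d)}
    (hinv : SeparatelyTranslationInvariant Θ) (x y : EuclideanSpace ℝ (Fin d))
    {B : Set (Line d × Line d)} (hB : MeasurableSet B) :
    Θ ((fun G : Line d × Line d => (G.1.translate x, G.2.translate y)) ⁻¹' B) = Θ B := by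
  rw [← hinv B hB (-x) (-y)]
  congr 1
  ext ⟨L₁, L₂⟩
  constructor
  · intro h
    exact ⟨_, h, by simp [Line.translate_translate, Line.translate_zero]⟩
  · rintro ⟨⟨G₁, G₂⟩, h, h'⟩
    simp only [Prod.mk.injEq] at h'
    obtain ⟨rfl, rfl⟩ := h'
    simpa [Line.translate_translate, Line.translate_zero] using h

theorem Line.continuous_translate_left (x : EuclideanSpace ℝ (Fin d)) :
    Continuous fun L : Line d => L.translate x :=
  Line.continuous_translate.comp (f := fun L : Line d => (x, L)) (by fun_prop)

/-- `J` is proportional to the product of the brightnesses. -/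
theorem brightness_mul_J {Θ : Measure (Line d × Line d)} [SFinite Θ]
    (hinv : SeparatelyTranslationInvariant Θ)
    {K₁ K₂ C : ConvexBody (EuclideanSpace ℝ (Fin d))} {b₁ b₂ c : ℝ≥0∞}
    (h₁ : BrightnessEq (K₁ : Set (EuclideanSpace ℝ (Fin d))) b₁)
    (h₂ : BrightnessEq (K₂ : Set (EuclideanSpace ℝ (Fin d))) b₂)
    (hc : BrightnessEq (C : Set (EuclideanSpace ℝ (Fin d))) c) :
    c * (c * J K₁ K₂ Θ) = b₁ * (b₂ * J C C Θ) := by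
  have hJ : ∀ K L : ConvexBody (EuclideanSpace ℝ (Fin d)), J K L Θ =
      Θ (hits (K : Set (EuclideanSpace ℝ (Fin d))) ×ˢ
        hits (L : Set (EuclideanSpace ℝ (Fin d)))) := fun _ _ => rfl
  have hmeas : ∀ K : ConvexBody (EuclideanSpace ℝ (Fin d)),
      MeasurableSet (hits (K : Set (EuclideanSpace ℝ (Fin d)))) := fun K =>
    (isClosed_hits K.isCompact).measurableSet
  have hfst := brightness_mul_measure_hits (Θ := Θ) (fun x B hB => by
    simpa [Line.translate_zero] using hinv.measure_preimage x 0 hB)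
    K₁.isCompact C.isCompact h₁ hc (hmeas K₂)
  have hswap : ∀ S T : Set (Line d), MeasurableSet S → MeasurableSet T →
      Θ.map Prod.swap (S ×ˢ T) = Θ (T ×ˢ S) := fun S T hS hT => by
    rw [Measure.map_apply measurable_swap (hS.prod hT), Set.preimage_swap_prod]
  have hsnd := brightness_mul_measure_hits (Θ := Θ.map Prod.swap) (fun x B hB => by
    have hm : Measurable fun G : Line d × Line d => (G.1.translate x, G.2) :=
      ((Line.continuous_translate_left x).measurable.comp measurable_fst).prodMk measurable_snd
    rw [Measure.map_apply measurable_swap (hm hB), Measure.map_apply measurable_swap hB,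
      ← hinv.measure_preimage 0 x (measurable_swap hB)]
    simp only [Line.translate_zero]
    rfl) K₂.isCompact C.isCompact h₂ hc (hmeas C)
  rw [hswap _ _ (hmeas K₂) (hmeas C), hswap _ _ (hmeas C) (hmeas C)] at hsnd
  rw [hJ, hJ, hfst, mul_left_comm, hsnd]

theorem J_lt_top {Θ : Measure (Line d × Line d)} [IsLocallyFiniteMeasure Θ]
    (K₁ K₂ : ConvexBody (EuclideanSpace ℝ (Fin d))) : J K₁ K₂ Θ < ⊤ :=
  ((isCompact_hits K₁.isCompact).prod (isCompact_hits K₂.isCompact)).measure_lt_top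

/-! ### Surface area and brightness -/

theorem brightness_nonneg (K : ConvexBody (EuclideanSpace ℝ (Fin d)))
    (u : EuclideanSpace ℝ (Fin d)) : 0 ≤ brightness K u :=
  measureReal_nonneg

theorem brightnessEq_of_brightness {K : ConvexBody (EuclideanSpace ℝ (Fin d))} {b : ℝ}
    (h : ∀ u : EuclideanSpace ℝ (Fin d), ‖u‖ = 1 → brightness K u = b) :
    BrightnessEq (K : Set (EuclideanSpace ℝ (Fin d))) (ENNReal.ofReal b) := fun u hu => by
  rw [← h u hu, brightness,
    ofReal_measureReal (isCompact_projection_image K.isCompact).measure_lt_top.ne]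

theorem projection_closedBall (u : EuclideanSpace ℝ (Fin d)) :
    (Submodule.span ℝ {u})ᗮ.orthogonalProjectionOnto ''
      (unitBall d : Set (EuclideanSpace ℝ (Fin d))) = Metric.closedBall 0 1 := by
  ext y
  constructor
  · rintro ⟨x, hx, rfl⟩
    exact mem_closedBall_zero_iff.2 ((Submodule.norm_orthogonalProjectionOnto_apply_le _ x).trans
      (mem_closedBall_zero_iff.1 hx))
  · intro hy
    exact ⟨y, mem_closedBall_zero_iff.2 (by simpa using mem_closedBall_zero_iff.1 hy),
      Submodule.orthogonalProjectionOnto_mem_subspace_eq_self y⟩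

/-- The unit ball has constant positive brightness. -/
theorem exists_brightness_unitBall (hd : 2 ≤ d) :
    ∃ c : ℝ, 0 < c ∧ ∀ u : EuclideanSpace ℝ (Fin d), ‖u‖ = 1 → brightness (unitBall d) u = c := by
  obtain ⟨n, rfl⟩ : ∃ n, d = n + 1 := ⟨d - 1, by omega⟩
  have : Nonempty (Fin n) := ⟨⟨0, by omega⟩⟩
  refine ⟨(volume : Measure (EuclideanSpace ℝ (Fin n))).real (Metric.closedBall 0 1),
    ENNReal.toReal_pos (Metric.measure_closedBall_pos volume _ one_pos).ne'
      measure_closedBall_lt_top.ne, fun u hu => ?_⟩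
  have hu0 : u ≠ 0 := by rintro rfl; simp at hu
  have hfin : Module.finrank ℝ (Submodule.span ℝ {u})ᗮ = n := by
    have : Fact (Module.finrank ℝ (EuclideanSpace ℝ (Fin (n + 1))) = n + 1) := ⟨by simp⟩
    exact Submodule.finrank_orthogonal_span_singleton hu0
  let R := ((stdOrthonormalBasis ℝ (Submodule.span ℝ {u})ᗮ).reindex (finCongr hfin)).repr
  rw [brightness, projection_closedBall, measureReal_def, measureReal_def,
    ← R.measurePreserving.measure_preimage measurableSet_closedBall.nullMeasurableSet,
    R.preimage_closedBall, map_zero]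

theorem smul_unitBall {t : ℝ} (ht : 0 ≤ t) :
    t • (unitBall d : Set (EuclideanSpace ℝ (Fin d))) = Metric.closedBall 0 t := by
  change t • Metric.closedBall (0 : EuclideanSpace ℝ (Fin d)) 1 = _
  rw [smul_closedBall t 0 zero_le_one, smul_zero, mul_one, Real.norm_of_nonneg ht]

theorem surfaceArea_eq_of_hasDerivWithinAt {K : ConvexBody (EuclideanSpace ℝ (Fin d))} {σ : ℝ}
    (h : HasDerivWithinAt (fun t : ℝ => volume.real
      ((K : Set (EuclideanSpace ℝ (Fin d))) + Metric.closedBall 0 t)) σ (Set.Ici 0) 0) :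
    surfaceArea K = σ := by
  have h' := h.congr (fun t (ht : 0 ≤ t) => by rw [smul_unitBall ht])
    (f₁ := fun t : ℝ => volume.real ((K : Set (EuclideanSpace ℝ (Fin d))) +
      t • (unitBall d : Set (EuclideanSpace ℝ (Fin d))))) (by rw [smul_unitBall le_rfl])
  exact h'.derivWithin (uniqueDiffWithinAt_Ici 0)

theorem hasDerivWithinAt_volume_unitBall :
    HasDerivWithinAt (fun t : ℝ => volume.real ((unitBall d : Set (EuclideanSpace ℝ (Fin d))) +
      Metric.closedBall 0 t))
      (d * (volume : Measure (EuclideanSpace ℝ (Fin d))).real (Metric.ball 0 1))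
      (Set.Ici 0) 0 := by
  have h : HasDerivWithinAt (fun t : ℝ => (1 + t) ^ d *
      (volume : Measure (EuclideanSpace ℝ (Fin d))).real (Metric.ball 0 1))
      (d * (volume : Measure (EuclideanSpace ℝ (Fin d))).real (Metric.ball 0 1))
      (Set.Ici 0) 0 := by
    have h1 := (((hasDerivAt_id (0 : ℝ)).const_add 1).pow d).mul_const
      ((volume : Measure (EuclideanSpace ℝ (Fin d))).real (Metric.ball 0 1))
    simpa using h1.hasDerivWithinAt
  have hvol : ∀ t : ℝ, 0 ≤ t → volume.real ((unitBall d : Set (EuclideanSpace ℝ (Fin d))) +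
      Metric.closedBall 0 t) = (1 + t) ^ d *
        (volume : Measure (EuclideanSpace ℝ (Fin d))).real (Metric.ball 0 1) := fun t ht => by
    change volume.real (Metric.closedBall (0 : EuclideanSpace ℝ (Fin d)) 1 + _) = _
    rw [closedBall_add_closedBall zero_le_one ht, add_zero, measureReal_def,
      Measure.addHaar_closedBall volume _ (by positivity), finrank_euclideanSpace_fin,
      ENNReal.toReal_mul, ENNReal.toReal_ofReal (by positivity), measureReal_def]
  exact h.congr (fun t ht => hvol t ht) (hvol 0 le_rfl)

theorem surfaceArea_unitBall_pos (hd : 2 ≤ d) : 0 < surfaceArea (unitBall d) := by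
  rw [surfaceArea_eq_of_hasDerivWithinAt hasDerivWithinAt_volume_unitBall]
  have : 0 < d := by omega
  have : 0 < (volume : Measure (EuclideanSpace ℝ (Fin d))).real (Metric.ball 0 1) :=
    ENNReal.toReal_pos (Metric.measure_ball_pos volume _ one_pos).ne' measure_ball_lt_top.ne
  positivity

/-- Cauchy's surface area formula for bodies of constant brightness. -/
theorem surfaceArea_eq_mul_brightness (hd : 2 ≤ d) {c : ℝ} (hc0 : 0 < c)
    (hc : ∀ u : EuclideanSpace ℝ (Fin d), ‖u‖ = 1 → brightness (unitBall d) u = c)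
    {K : ConvexBody (EuclideanSpace ℝ (Fin d))} {b : ℝ} (hb0 : 0 ≤ b)
    (hb : ∀ u : EuclideanSpace ℝ (Fin d), ‖u‖ = 1 → brightness K u = b) :
    surfaceArea K = surfaceArea (unitBall d) / c * b := by
  have : Nonempty (Fin d) := ⟨⟨0, by omega⟩⟩
  rw [surfaceArea_eq_of_hasDerivWithinAt hasDerivWithinAt_volume_unitBall]
  exact surfaceArea_eq_of_hasDerivWithinAt (hasDerivWithinAt_volume_parallel
    (unitBall d).isCompact (unitBall d).convex hc0 hc hasDerivWithinAt_volume_unitBall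
    K.isCompact K.convex hb0 hb)

end LinePairs

theorem theorem1p2 (d : ℕ) (hd : 2 ≤ d)
    (Θ : MeasureTheory.Measure (LinePairs.Line d × LinePairs.Line d))
    (hfin : MeasureTheory.IsLocallyFiniteMeasure Θ)
    (hinv : LinePairs.SeparatelyTranslationInvariant Θ)
    (K₁ K₂ : ConvexBody (EuclideanSpace ℝ (Fin d)))
    (hK₁ : LinePairs.HasConstantBrightness K₁) (hK₂ : LinePairs.HasConstantBrightness K₂) :
    LinePairs.kappa Θ < ⊤ ∧
      LinePairs.J K₁ K₂ Θ =
        LinePairs.kappa Θ * ENNReal.ofReal (LinePairs.surfaceArea K₁) *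
          ENNReal.ofReal (LinePairs.surfaceArea K₂) := by
  open LinePairs in
  obtain ⟨c, hc0, hc⟩ := exists_brightness_unitBall hd
  obtain ⟨b₁, h₁⟩ := hK₁
  obtain ⟨b₂, h₂⟩ := hK₂
  have : Nonempty (Fin d) := ⟨⟨0, by omega⟩⟩
  obtain ⟨e, he⟩ := exists_norm_eq (EuclideanSpace ℝ (Fin d)) zero_le_one
  have hb₁ : 0 ≤ b₁ := h₁ e he ▸ brightness_nonneg K₁ e
  have hb₂ : 0 ≤ b₂ := h₂ e he ▸ brightness_nonneg K₂ e
  have hS := surfaceArea_unitBall_pos hd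
  have hJ := brightness_mul_J hinv (brightnessEq_of_brightness h₁) (brightnessEq_of_brightness h₂)
    (brightnessEq_of_brightness hc)
  rw [surfaceArea_eq_mul_brightness hd hc0 hc hb₁ h₁,
    surfaceArea_eq_mul_brightness hd hc0 hc hb₂ h₂, kappa]
  lift J K₁ K₂ Θ to NNReal using (J_lt_top K₁ K₂).ne with j
  lift J (unitBall d) (unitBall d) Θ to NNReal using (J_lt_top _ _).ne with k
  set S := surfaceArea (unitBall d)
  have hS2 : ENNReal.ofReal S ^ 2 ≠ 0 := pow_ne_zero _ (ENNReal.ofReal_pos.2 hS).ne'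
  have hkappa : (k : ENNReal) / ENNReal.ofReal S ^ 2 ≠ ⊤ :=
    ENNReal.div_ne_top ENNReal.coe_ne_top hS2
  refine ⟨hkappa.lt_top, ?_⟩
  have hJ' := congrArg ENNReal.toReal hJ
  simp only [ENNReal.toReal_mul, ENNReal.toReal_ofReal hc0.le, ENNReal.toReal_ofReal hb₁,
    ENNReal.toReal_ofReal hb₂, ENNReal.coe_toReal] at hJ'
  rw [← ENNReal.toReal_eq_toReal_iff' ENNReal.coe_ne_top (ENNReal.mul_ne_top
    (ENNReal.mul_ne_top hkappa ENNReal.ofReal_ne_top) ENNReal.ofReal_ne_top)]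
  rw [ENNReal.toReal_mul, ENNReal.toReal_mul, ENNReal.toReal_div, ENNReal.toReal_pow,
    ENNReal.toReal_ofReal hS.le, ENNReal.toReal_ofReal (by positivity),
    ENNReal.toReal_ofReal (by positivity), ENNReal.coe_toReal, ENNReal.coe_toReal]
  have hS0 := hS.ne'
  field_simp
  linarith
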